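/- For an integer $n \ge 0$, let $c_6(n)$ be the number of partitions of $n$ satisfying at least one of the following two conditions: (a) $1$ is the only odd part that may appear (with any multiplicity), and the even parts are distinct; (b) there is an integer $j \ge 1$ such that each of the even numbers $2, 4, \dots, 2j$ appears as a part exactly twice, every even part larger than $2j$ is at least $4j+2$ and appears only once, all odd parts are at most $2j+1$, and the odd parts that are at most $2j-1$ are distinct (the part $2j+1$ may appear any number of times, including zero). Then for all $n \ge 0$, $$ c_{6}(n) \equiv \begin{cases} 1 \pmod{2}, & \text{if } n = (7j^2 + 5j)/2 \text{ for some } j \in \mathbb{Z},\\ 0 \pmod{2}, & \text{otherwise.} \end{cases} $$ -/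

import Mathlib

/-- The even parts of `p` are distinct and `1` is the only odd part that may appear
(with any multiplicity). -/
def OnlyOneOddDistinctEven {n : ℕ} (p : n.Partition) : Prop :=
  (∀ i ∈ p.parts, Odd i → i = 1) ∧
  (∀ i ∈ p.parts, Even i → p.parts.count i = 1)

/-- For some `j ≥ 1`: each of the even parts `2, 4, …, 2j` appears exactly twice; every even part
larger than `2j` is at least `4j + 2` and appears only once; every odd part is at most `2j + 1`,
and the odd parts that are at most `2j - 1` appear only once (the part `2j + 1` may appear any
number of times). -/
def HasInitialEvenRepetitions {n : ℕ} (p : n.Partition) : Prop :=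
  ∃ j : ℕ, 1 ≤ j ∧
    (∀ i : ℕ, 1 ≤ i → i ≤ j → p.parts.count (2 * i) = 2) ∧
    (∀ i ∈ p.parts, Even i → 2 * j < i → 4 * j + 2 ≤ i ∧ p.parts.count i = 1) ∧
    (∀ i ∈ p.parts, Odd i → i ≤ 2 * j + 1) ∧
    (∀ i ∈ p.parts, Odd i → i ≤ 2 * j - 1 → p.parts.count i = 1)

/-- The number of partitions of `n` of one of the two kinds above. -/
noncomputable def c₆ (n : ℕ) : ℕ :=
  Nat.card {p : n.Partition // OnlyOneOddDistinctEven p ∨ HasInitialEvenRepetitions p}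

/-! Condition (a) is the case j = 0 of (b), and the cases are disjoint. For fixed j the generating
function is X^(2j(j+1)) · ∏_{m<j} (1 + X^(2m+1)) · 1/(1 - X^(2j+1)) · ∏_{i≥2j+1} (1 + X^(2i)).
Modulo 2 the factor i = 2j+1 is (1 - X^(2j+1))(1 + X^(2j+1)), which cancels the geometric series.
Summing over j gives the series side of the third Rogers–Selberg identity modulo 2.

That identity follows from a Bailey-type argument, run at a finite level L. `pentagonalSum_eq_prod`
expands ∏_{i≤n} (1 + q^(2i+1)) in Gaussian binomials with pentagonal exponents. After the sums are
exchanged, `qBinom_mul_qRise_three` reduces the inner one to `sum_qBinom_mul_qRise`, whose value is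
1. The surviving exponents are (7j² + 5j)/2 at j = s and j = -1-s, all distinct. For L = N,
`pow_dvd_qRise_sub_one` shows that the finite correction factors do not reach the coefficient of
X^N. -/

open Finset

/-! ### Gaussian binomials and the finite Durfee rectangle identity. -/

section QBinomial

variable {A : Type*} [CommRing A]

/-- The shifted `q`-factorial `(1 - q ^ (a + 1)) ⋯ (1 - q ^ (a + b))`. -/
def qRise (q : A) (a b : ℕ) : A := ∏ i ∈ range b, (1 - q ^ (a + 1 + i))

/-- The Gaussian binomial coefficient, defined by the `q`-Pascal recursion. -/
def qBinom (q : A) : ℕ → ℕ → A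
  | _, 0 => 1
  | 0, _ + 1 => 0
  | n + 1, k + 1 => qBinom q n k + q ^ (k + 1) * qBinom q n (k + 1)

@[simp] lemma qRise_zero (q : A) (a : ℕ) : qRise q a 0 = 1 := by simp [qRise]

lemma qRise_succ (q : A) (a b : ℕ) :
    qRise q a (b + 1) = qRise q a b * (1 - q ^ (a + b + 1)) := by
  rw [qRise, prod_range_succ, ← qRise]; congr 3; ring

lemma qRise_succ' (q : A) (a b : ℕ) :
    qRise q a (b + 1) = (1 - q ^ (a + 1)) * qRise q (a + 1) b := by
  rw [qRise, prod_range_succ', mul_comm]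
  congr 1
  exact prod_congr rfl fun i _ => by congr 2; ring

lemma qRise_mul_qRise (q : A) (a b c : ℕ) :
    qRise q a b * qRise q (a + b) c = qRise q a (b + c) := by
  induction c with
  | zero => simp
  | succ c ih => rw [qRise_succ, ← mul_assoc, ih, ← add_assoc, qRise_succ]; congr 3; ring

lemma pow_dvd_qRise_sub_one (q : A) (a b : ℕ) : q ^ (a + 1) ∣ qRise q a b - 1 := by
  induction b with
  | zero => simp
  | succ b ih =>
    have : qRise q a (b + 1) - 1 = (qRise q a b - 1) - q ^ (a + 1) * (q ^ b * qRise q a b) := by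
      rw [qRise_succ]; ring
    rw [this]
    exact dvd_sub ih (dvd_mul_right _ _)

@[simp] lemma qBinom_zero_right (q : A) (n : ℕ) : qBinom q n 0 = 1 := by
  cases n <;> simp [qBinom]

lemma qBinom_succ_succ (q : A) (n k : ℕ) :
    qBinom q (n + 1) (k + 1) = qBinom q n k + q ^ (k + 1) * qBinom q n (k + 1) := by
  simp [qBinom]

lemma qBinom_eq_zero (q : A) : ∀ {n k : ℕ}, n < k → qBinom q n k = 0
  | 0, k + 1, _ => by simp [qBinom]
  | n + 1, k + 1, h => by
    rw [qBinom_succ_succ, qBinom_eq_zero q (by omega), qBinom_eq_zero q (by omega)]; simp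

@[simp] lemma qBinom_self (q : A) (n : ℕ) : qBinom q n n = 1 := by
  induction n with
  | zero => simp
  | succ n ih => rw [qBinom_succ_succ, ih, qBinom_eq_zero q (by omega)]; simp

lemma qBinom_succ_succ' (q : A) : ∀ {n k : ℕ}, k ≤ n →
    qBinom q (n + 1) (k + 1) = q ^ (n - k) * qBinom q n k + qBinom q n (k + 1)
  | 0, 0, _ => by simp [qBinom]
  | n + 1, 0, _ => by
    have h := qBinom_succ_succ' q (Nat.zero_le n)
    rw [qBinom_succ_succ]
    simp only [zero_add, qBinom_zero_right, Nat.sub_zero] at h ⊢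
    have h2 := qBinom_succ_succ q n 0
    simp only [zero_add, qBinom_zero_right] at h2
    linear_combination q * h - h2
  | n + 1, k + 1, hk => by
    rcases (by omega : k = n ∨ k + 1 ≤ n) with rfl | hk'
    · rw [qBinom_self, qBinom_self, qBinom_eq_zero q (by omega)]; simp
    · have h1 := qBinom_succ_succ' q (n := n) (k := k) (by omega)
      have h2 := qBinom_succ_succ' q (n := n) (k := k + 1) hk'
      have h3 := qBinom_succ_succ q n k
      have h4 := qBinom_succ_succ q n (k + 1)
      obtain ⟨d, rfl⟩ := Nat.exists_eq_add_of_le hk'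
      rw [qBinom_succ_succ]
      rw [show k + 1 + d - k = d + 1 by omega] at h1
      rw [show k + 1 + d - (k + 1) = d by omega] at h2
      rw [show k + 1 + d + 1 - (k + 1) = d + 1 by omega]
      linear_combination h1 + q ^ (k + 2) * h2 - q ^ (d + 1) * h3 - h4

lemma qBinom_symm (q : A) : ∀ a b : ℕ, qBinom q (a + b) a = qBinom q (a + b) b
  | 0, b => by simp
  | a + 1, 0 => by simp
  | a + 1, b + 1 => by
    have h1 := qBinom_symm q a (b + 1)
    have h2 := qBinom_symm q (a + 1) b
    rw [show a + 1 + (b + 1) = a + (b + 1) + 1 by ring, qBinom_succ_succ,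
      qBinom_succ_succ' q (by omega), h1, show a + (b + 1) = a + 1 + b by ring, h2,
      show a + 1 + b - b = a + 1 by omega]
    ring

lemma qBinom_mul_qRise (q : A) : ∀ a b : ℕ,
    qBinom q (a + b) a * qRise q 0 a * qRise q 0 b = qRise q 0 (a + b)
  | 0, b => by simp
  | a + 1, 0 => by simp
  | a + 1, b + 1 => by
    have h1 := qBinom_mul_qRise q a (b + 1)
    have h2 := qBinom_mul_qRise q (a + 1) b
    rw [show a + 1 + (b + 1) = a + (b + 1) + 1 by ring, qBinom_succ_succ]
    rw [show a + 1 + b = a + (b + 1) by ring] at h2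
    rw [qRise_succ q 0 (a + (b + 1))]
    rw [qRise_succ q 0 b] at h1 ⊢
    rw [qRise_succ q 0 a] at h2 ⊢
    linear_combination (1 - q ^ (0 + a + 1)) * h1 + q ^ (a + 1) * (1 - q ^ (0 + b + 1)) * h2

/-- A finite form of the Durfee rectangle identity. -/
lemma sum_qBinom_mul_qRise (q : A) (M : ℕ) : ∀ k : ℕ,
    ∑ m ∈ range (M + 1), q ^ (m * (m + k)) * qBinom q M m * qRise q (m + k) (M - m) = 1 := by
  induction M with
  | zero => simp
  | succ M ih =>
    intro k
    -- Pascal splits off q^(M+k+1) times the sum for (M, k+1). The rest, with the m = 0 term, is 1 -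
    -- q^(M+k+1) times the sum for (M, k).
    have key : ∀ m ∈ range (M + 1),
        q ^ ((m + 1) * (m + 1 + k)) * qBinom q (M + 1) (m + 1) *
          qRise q (m + 1 + k) (M + 1 - (m + 1)) =
        q ^ (M + k + 1) *
          (q ^ (m * (m + (k + 1))) * qBinom q M m * qRise q (m + (k + 1)) (M - m)) +
        q ^ ((m + 1) * (m + 1 + k)) * qBinom q M (m + 1) *
          qRise q (m + 1 + k) (M + 1 - (m + 1)) := by
      intro m hm
      obtain ⟨d, rfl⟩ := Nat.exists_eq_add_of_le (Nat.lt_succ_iff.1 (mem_range.1 hm))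
      rw [qBinom_succ_succ' q (by omega), show m + d + 1 - (m + 1) = d by omega,
        show m + d - m = d by omega, show m + 1 + k = m + (k + 1) by ring]
      ring
    rw [sum_range_succ', sum_congr rfl key, sum_add_distrib, ← mul_sum, ih, add_assoc]
    have h0 := sum_range_succ' (fun m => q ^ (m * (m + k)) * qBinom q M m *
          qRise q (m + k) (M + 1 - m)) (M + 1)
    simp only [qBinom_zero_right] at h0 ⊢
    rw [← h0, sum_range_succ, qBinom_eq_zero q (Nat.lt_succ_self M)]
    have h1 : ∀ m ∈ range (M + 1),
        q ^ (m * (m + k)) * qBinom q M m * qRise q (m + k) (M + 1 - m) =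
        (1 - q ^ (M + k + 1)) *
          (q ^ (m * (m + k)) * qBinom q M m * qRise q (m + k) (M - m)) := by
      intro m hm
      obtain ⟨d, rfl⟩ := Nat.exists_eq_add_of_le (Nat.lt_succ_iff.1 (mem_range.1 hm))
      rw [show m + d + 1 - m = d + 1 by omega, show m + d - m = d by omega, qRise_succ]
      ring
    rw [sum_congr rfl h1, ← mul_sum, ih]
    ring

end QBinomial

/-! ### The pentagonal expansion of ∏ (1 + q^(2i+1)) in characteristic two. -/

section CharTwo

variable {A : Type*} [CommRing A]

/-- The generalized pentagonal number `r (3 r + 1) / 2`. -/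
def genPentagonal (r : ℤ) : ℕ := (r * (3 * r + 1) / 2).toNat

lemma two_mul_genPentagonal (r : ℤ) : 2 * (genPentagonal r : ℤ) = r * (3 * r + 1) := by
  have h2 : (2 : ℤ) ∣ r * (3 * r + 1) := by
    rcases Int.even_or_odd' r with ⟨k, rfl | rfl⟩
    · exact ⟨k * (3 * (2 * k) + 1), by ring⟩
    · exact ⟨(2 * k + 1) * (3 * k + 2), by ring⟩
  have h0 : 0 ≤ r * (3 * r + 1) := by
    rcases le_or_gt 0 r with h | h
    · positivity
    · exact mul_nonneg_of_nonpos_of_nonpos h.le (by omega)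
  rw [genPentagonal, Int.toNat_of_nonneg (by omega)]
  exact Int.mul_ediv_cancel' h2

/-- A signless finite pentagonal sum with Gaussian binomials in base `q ^ 2`. -/
def pentagonalSum (q : A) (n N : ℕ) : A :=
  ∑ k ∈ range (N + 1), q ^ genPentagonal ((n : ℤ) - k) * qBinom (q ^ 2) N k

/-- Of the two Pascal summands, one gives the sum for 2n unchanged; the other gives it reflected by
k ↦ 2n - k, with the constant factor q^(2n+1). -/
lemma pentagonalSum_two_mul_add_one (q : A) (n : ℕ) :
    pentagonalSum q n (2 * n + 1) = (1 + q ^ (2 * n + 1)) * pentagonalSum q n (2 * n) := by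
  have key : ∀ k ∈ range (2 * n + 1),
      q ^ genPentagonal ((n : ℤ) - (k + 1 : ℕ)) * qBinom (q ^ 2) (2 * n + 1) (k + 1) =
      q ^ (2 * n + 1) * (q ^ genPentagonal ((n : ℤ) - (2 * n - k : ℕ)) *
        qBinom (q ^ 2) (2 * n) (2 * n - k)) +
      q ^ genPentagonal ((n : ℤ) - (k + 1 : ℕ)) * qBinom (q ^ 2) (2 * n) (k + 1) := by
    intro k hk
    have hk' : k ≤ 2 * n := by simpa [Nat.lt_succ_iff] using hk
    have hs := qBinom_symm (q ^ 2) k (2 * n - k)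
    rw [Nat.add_sub_cancel' hk'] at hs
    rw [qBinom_succ_succ' _ hk', ← hs, mul_add, ← mul_assoc, ← mul_assoc, ← pow_mul, ← pow_add,
      ← pow_add]
    congr 3
    have h1 := two_mul_genPentagonal ((n : ℤ) - (k + 1 : ℕ))
    have h2 := two_mul_genPentagonal ((n : ℤ) - (2 * n - k : ℕ))
    zify [hk'] at h1 h2 ⊢
    linarith
  rw [pentagonalSum, sum_range_succ', sum_congr rfl key, sum_add_distrib, ← mul_sum, add_assoc]
  have h0 := sum_range_succ' (fun k => q ^ genPentagonal ((n : ℤ) - k) * qBinom (q ^ 2) (2 * n) k)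
    (2 * n + 1)
  simp only [qBinom_zero_right] at h0 ⊢
  rw [← h0, sum_range_succ _ (2 * n + 1), qBinom_eq_zero _ (Nat.lt_succ_self (2 * n)), mul_zero,
    add_zero, add_mul, one_mul, add_comm, pentagonalSum]
  congr 2
  have := sum_range_reflect (fun k => q ^ genPentagonal ((n : ℤ) - k) * qBinom (q ^ 2) (2 * n) k)
    (2 * n + 1)
  rw [← this]
  exact sum_congr rfl fun k _ => by rw [Nat.add_sub_cancel]

lemma sum_range_two_mul_eq_zero_of_symm [CharP A 2] (m : ℕ) (g : ℕ → A)
    (h : ∀ k < 2 * m, g (2 * m - 1 - k) = g k) : ∑ k ∈ range (2 * m), g k = 0 := by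
  refine sum_involution (fun k _ => 2 * m - 1 - k) ?_ ?_ ?_ ?_
  · intro k hk
    rw [h k (mem_range.1 hk)]
    exact CharTwo.add_self_eq_zero _
  · intro k hk _
    have := mem_range.1 hk
    omega
  · intro k hk
    have := mem_range.1 hk
    rw [mem_range]; omega
  · intro k hk
    have := mem_range.1 hk
    omega

/-- One Pascal summand is the right side. The other has 2n+2 terms invariant under k ↦ 2n+1-k, which
cancel in pairs modulo 2. -/
lemma pentagonalSum_two_mul_add_two [CharP A 2] (q : A) (n : ℕ) :
    pentagonalSum q (n + 1) (2 * (n + 1)) = pentagonalSum q n (2 * n + 1) := by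
  have key : ∀ k ∈ range (2 * n + 1 + 1),
      q ^ genPentagonal (((n + 1 : ℕ) : ℤ) - (k + 1 : ℕ)) * qBinom (q ^ 2) (2 * n + 1 + 1) (k + 1) =
      q ^ genPentagonal ((n : ℤ) - k) * qBinom (q ^ 2) (2 * n + 1) k +
      q ^ (genPentagonal (((n + 1 : ℕ) : ℤ) - (k + 1 : ℕ)) + 2 * (k + 1)) *
        qBinom (q ^ 2) (2 * n + 1) (k + 1) := by
    intro k hk
    rw [qBinom_succ_succ, mul_add, ← mul_assoc, ← pow_mul, ← pow_add]
    congr 4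
    push_cast; ring
  rw [pentagonalSum, show 2 * (n + 1) = 2 * n + 1 + 1 by ring, sum_range_succ',
    sum_congr rfl key, sum_add_distrib, add_assoc, pentagonalSum]
  have h0 := sum_range_succ' (fun k => q ^ (genPentagonal (((n + 1 : ℕ) : ℤ) - k) + 2 * k) *
    qBinom (q ^ 2) (2 * n + 1) k) (2 * n + 1 + 1)
  simp only [qBinom_zero_right, mul_zero, add_zero] at h0 ⊢
  rw [← h0, sum_range_succ _ (2 * n + 1 + 1), qBinom_eq_zero _ (Nat.lt_succ_self (2 * n + 1)),
    mul_zero, add_zero, show 2 * n + 1 + 1 = 2 * (n + 1) by ring]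
  refine add_eq_left.2 (sum_range_two_mul_eq_zero_of_symm _ _ fun k hk => ?_)
  have hk' : k ≤ 2 * n + 1 := by omega
  have hs := qBinom_symm (q ^ 2) k (2 * n + 1 - k)
  rw [Nat.add_sub_cancel' hk'] at hs
  rw [show 2 * (n + 1) - 1 - k = 2 * n + 1 - k by omega, ← hs]
  congr 2
  have h1 := two_mul_genPentagonal (((n + 1 : ℕ) : ℤ) - k)
  have h2 := two_mul_genPentagonal (((n + 1 : ℕ) : ℤ) - (2 * n + 1 - k : ℕ))
  zify [hk'] at h1 h2 ⊢
  linarith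

/-- A finite form of the pentagonal number theorem modulo two. -/
lemma pentagonalSum_eq_prod [CharP A 2] (q : A) (n : ℕ) :
    pentagonalSum q n (2 * n + 1) = ∏ i ∈ range (n + 1), (1 + q ^ (2 * i + 1)) := by
  induction n with
  | zero => rw [pentagonalSum_two_mul_add_one]; simp [pentagonalSum, genPentagonal]
  | succ n ih =>
    rw [pentagonalSum_two_mul_add_one, pentagonalSum_two_mul_add_two, ih, prod_range_succ _ (n + 1),
      mul_comm]

/-- The indices k = n-s and k = n+1+s add up to 2n+1, so they share a binomial; their pentagonal
exponents differ by 2s+1. -/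
lemma pentagonalSum_eq_sum_symm (q : A) (n : ℕ) :
    pentagonalSum q n (2 * n + 1) = ∑ s ∈ range (n + 1),
      q ^ genPentagonal s * (1 + q ^ (2 * s + 1)) * qBinom (q ^ 2) (2 * n + 1) (n - s) := by
  rw [pentagonalSum, show 2 * n + 1 + 1 = (n + 1) + (n + 1) by ring, sum_range_add,
    ← sum_range_reflect, ← sum_add_distrib]
  refine sum_congr rfl fun s hs => ?_
  obtain ⟨d, rfl⟩ := Nat.exists_eq_add_of_le (Nat.lt_succ_iff.1 (mem_range.1 hs))
  have h := qBinom_symm (q ^ 2) (s + d + 1 + s) d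
  rw [show s + d + 1 + s + d = 2 * (s + d) + 1 by ring] at h
  rw [h, show s + d + 1 - 1 - s = d by omega, show s + d - s = d by omega]
  have e1 : ((s + d : ℕ) : ℤ) - d = s := by push_cast; ring
  have e2 : genPentagonal (((s + d : ℕ) : ℤ) - (s + d + 1 + s : ℕ)) = genPentagonal s + (2 * s + 1) := by
    have h1 := two_mul_genPentagonal s
    have h2 := two_mul_genPentagonal (((s + d : ℕ) : ℤ) - (s + d + 1 + s : ℕ))
    zify at h1 h2 ⊢
    linarith
  rw [e1, e2, pow_add]
  ring

end CharTwo

/-! ### The Bailey-type summation. -/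

section Bailey

variable {A : Type*} [CommRing A] [IsDomain A]

/-- Once denominators are cleared, both sides are the product of the q-factorials of 2(s+m)+1+2d and
d+s+m; `hq` permits the cancellation. -/
lemma qBinom_mul_qRise_three (q : A) (hq : ∀ n : ℕ, 1 - q ^ (n + 1) ≠ 0) (s m d : ℕ) :
    qBinom q (2 * (s + m) + 1) m * qRise q (2 * (s + m) + 1) (2 * d) * qRise q d (s + m) =
    qBinom q (m + d) m * qRise q (2 * s + 1 + m) d *
      (qRise q (m + d) s * qRise q (2 * s + 1 + m + d) (m + d)) := by
  have hne : ∀ n, qRise q 0 n ≠ 0 := fun n => by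
    rw [qRise, prod_ne_zero_iff]
    intro i _
    rw [add_comm]
    simpa [add_comm] using hq i
  have h1 := qBinom_mul_qRise q m (2 * s + 1 + m)
  have h2 := qBinom_mul_qRise q m d
  have h3 := qRise_mul_qRise q 0 (2 * (s + m) + 1) (2 * d)
  have h4 := qRise_mul_qRise q 0 d (s + m)
  have h5 := qRise_mul_qRise q 0 (2 * s + 1 + m) d
  have h6 := qRise_mul_qRise q 0 (m + d) s
  have h7 := qRise_mul_qRise q 0 (2 * s + 1 + m + d) (m + d)
  simp only [zero_add] at h1 h2 h3 h4 h5 h6 h7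
  rw [show m + (2 * s + 1 + m) = 2 * (s + m) + 1 by ring] at h1
  rw [show 2 * s + 1 + m + d + (m + d) = 2 * (s + m) + 1 + 2 * d by ring] at h7
  rw [show m + d + s = d + (s + m) by ring] at h6
  refine mul_left_cancel₀ (mul_ne_zero (mul_ne_zero (hne m) (hne (2 * s + 1 + m))) (hne d)) ?_
  calc _ = (qBinom q (2 * (s + m) + 1) m * qRise q 0 m * qRise q 0 (2 * s + 1 + m)) *
        qRise q (2 * (s + m) + 1) (2 * d) * (qRise q 0 d * qRise q d (s + m)) := by ring
    _ = qRise q 0 (2 * (s + m) + 1 + 2 * d) * qRise q 0 (d + (s + m)) := by rw [h1, h3, h4]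
    _ = (qBinom q (m + d) m * qRise q 0 m * qRise q 0 d) * qRise q (m + d) s *
        ((qRise q 0 (2 * s + 1 + m) * qRise q (2 * s + 1 + m) d) *
          qRise q (2 * s + 1 + m + d) (m + d)) := by rw [h2, h5, h6, h7]; ring
    _ = _ := by ring

/-- A finite form of the third Rogers–Selberg identity, modulo two. -/
lemma rogersSelberg_finite [CharP A 2] (q : A) (hq : ∀ n : ℕ, 1 - (q ^ 2) ^ (n + 1) ≠ 0) (L : ℕ) :
    ∑ n ∈ range (L + 1), (q ^ 2) ^ (n ^ 2 + n) * (∏ i ∈ range (n + 1), (1 + q ^ (2 * i + 1))) *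
      qRise (q ^ 2) (2 * n + 1) (2 * (L - n)) * qRise (q ^ 2) (L - n) n =
    ∑ s ∈ range (L + 1), q ^ genPentagonal s * (1 + q ^ (2 * s + 1)) * (q ^ 2) ^ (s ^ 2 + s) *
      (qRise (q ^ 2) (L - s) s * qRise (q ^ 2) (L + s + 1) (L - s)) := by
  have h1 : ∀ n ∈ range (L + 1),
      (q ^ 2) ^ (n ^ 2 + n) * (∏ i ∈ range (n + 1), (1 + q ^ (2 * i + 1))) *
        qRise (q ^ 2) (2 * n + 1) (2 * (L - n)) * qRise (q ^ 2) (L - n) n =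
      ∑ s ∈ range (n + 1), (q ^ 2) ^ (n ^ 2 + n) * (q ^ genPentagonal s * (1 + q ^ (2 * s + 1)) *
        qBinom (q ^ 2) (2 * n + 1) (n - s)) *
        qRise (q ^ 2) (2 * n + 1) (2 * (L - n)) * qRise (q ^ 2) (L - n) n := by
    intro n _
    rw [← pentagonalSum_eq_prod, pentagonalSum_eq_sum_symm, mul_sum, sum_mul, sum_mul]
  rw [sum_congr rfl h1, sum_comm' (s' := fun s => Ico s (L + 1)) (t' := range (L + 1))
    (by intro n s; simp only [mem_range, mem_Ico]; omega)]
  refine sum_congr rfl fun s hs => ?_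
  obtain ⟨M, rfl⟩ := Nat.exists_eq_add_of_le (Nat.lt_succ_iff.1 (mem_range.1 hs))
  rw [sum_Ico_eq_sum_range, show s + M + 1 - s = M + 1 by omega]
  have h2 : ∀ m ∈ range (M + 1),
      (q ^ 2) ^ ((s + m) ^ 2 + (s + m)) * (q ^ genPentagonal s * (1 + q ^ (2 * s + 1)) *
        qBinom (q ^ 2) (2 * (s + m) + 1) (s + m - s)) *
        qRise (q ^ 2) (2 * (s + m) + 1) (2 * (s + M - (s + m))) *
        qRise (q ^ 2) (s + M - (s + m)) (s + m) =
      q ^ genPentagonal s * (1 + q ^ (2 * s + 1)) * (q ^ 2) ^ (s ^ 2 + s) *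
        (qRise (q ^ 2) M s * qRise (q ^ 2) (s + M + s + 1) M) *
        ((q ^ 2) ^ (m * (m + (2 * s + 1))) * qBinom (q ^ 2) M m *
          qRise (q ^ 2) (m + (2 * s + 1)) (M - m)) := by
    intro m hm
    obtain ⟨d, rfl⟩ := Nat.exists_eq_add_of_le (Nat.lt_succ_iff.1 (mem_range.1 hm))
    have h3 := qBinom_mul_qRise_three (q ^ 2) hq s m d
    rw [show s + (m + d) - (s + m) = d by omega, show s + m - s = m by omega,
      show m + d - m = d by omega, show m + (2 * s + 1) = 2 * s + 1 + m by ring,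
      show s + (m + d) + s + 1 = 2 * s + 1 + m + d by ring]
    calc _ = (q ^ 2) ^ ((s + m) ^ 2 + (s + m)) * (q ^ genPentagonal s * (1 + q ^ (2 * s + 1))) *
          (qBinom (q ^ 2) (2 * (s + m) + 1) m * qRise (q ^ 2) (2 * (s + m) + 1) (2 * d) *
            qRise (q ^ 2) d (s + m)) := by ring
      _ = _ := by
        rw [h3, show (s + m) ^ 2 + (s + m) = (s ^ 2 + s) + m * (2 * s + 1 + m) by ring, pow_add]
        ring
  rw [sum_congr rfl h2, ← mul_sum, sum_qBinom_mul_qRise, mul_one,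
    show s + M - s = M by omega]

end Bailey

/-! ### Generating functions for partitions with prescribed multiplicities. -/

section PartitionCount

open PowerSeries

/-- The power series `∑ X ^ (i * c)` over the multiplicities `c` satisfying `g`. -/
noncomputable def multiplicitySeries (R : Type*) [CommRing R] (i : ℕ) (g : ℕ → Prop) :
    PowerSeries R :=
  open Classical in PowerSeries.mk fun t => if i ∣ t ∧ g (t / i) then 1 else 0

/-- A partition amounts to the numbers l i = i · (multiplicity of i), which sum to n; these index
the terms of the coefficient. -/
lemma coeff_prod_multiplicitySeries (R : Type*) [CommRing R] (g : ℕ → ℕ → Prop) {n B : ℕ}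
    (hB : n ≤ B) :
    coeff n (∏ i ∈ Icc 1 B, multiplicitySeries R i (g i)) =
      (Nat.card {p : n.Partition // ∀ i ∈ Icc 1 B, g i (p.parts.count i)} : R) := by
  classical
  rw [coeff_prod]
  simp only [multiplicitySeries, coeff_mk, prod_boole, sum_boole]
  rw [Nat.card_eq_fintype_card, Fintype.card_subtype]
  congr 1
  symm
  refine card_bij (fun p _ => p.toFinsuppAntidiag) ?_ ?_ ?_
  · intro p hp
    rw [mem_filter] at hp ⊢
    refine ⟨finsuppAntidiag_mono (Icc_subset_Icc_right hB) _
      p.toFinsuppAntidiag_mem_finsuppAntidiag, fun i hi => ?_⟩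
    have hi0 : 0 < i := (mem_Icc.1 hi).1
    change i ∣ p.parts.count i * i ∧ g i (p.parts.count i * i / i)
    rw [Nat.mul_div_cancel _ hi0]
    exact ⟨dvd_mul_left _ _, hp.2 i hi⟩
  · intro p _ p' _ h
    exact Nat.Partition.toFinsuppAntidiag_injective n h
  · intro l hl
    rw [mem_filter, mem_finsuppAntidiag] at hl
    obtain ⟨⟨hsum, hsupp⟩, hl⟩ := hl
    have hcount : ∀ i, (∑ m ∈ Icc 1 B, Multiset.replicate (l m / m) m).count i =
        if i ∈ Icc 1 B then l i / i else 0 := by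
      intro i
      simp only [Multiset.count_sum', Multiset.count_replicate]
      rw [sum_ite_eq']
    let p : n.Partition :=
      { parts := ∑ m ∈ Icc 1 B, Multiset.replicate (l m / m) m
        parts_pos := by
          intro i hi
          rw [Multiset.mem_sum] at hi
          obtain ⟨m, hm, hi⟩ := hi
          rw [Multiset.eq_of_mem_replicate hi]
          exact (mem_Icc.1 hm).1
        parts_sum := by
          rw [Multiset.sum_sum, ← hsum]
          refine sum_congr rfl fun i hi => ?_
          rw [Multiset.sum_replicate, smul_eq_mul, Nat.div_mul_cancel (hl i hi).1] }
    refine ⟨p, ?_, ?_⟩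
    · rw [mem_filter]
      refine ⟨mem_univ _, fun i hi => ?_⟩
      change g i ((∑ m ∈ Icc 1 B, Multiset.replicate (l m / m) m).count i)
      rw [hcount, if_pos hi]
      exact (hl i hi).2
    · ext i
      change (∑ m ∈ Icc 1 B, Multiset.replicate (l m / m) m).count i * i = l i
      rw [hcount]
      split_ifs with hi
      · exact Nat.div_mul_cancel (hl i hi).1
      · rw [zero_mul]
        by_contra h
        exact hi (hsupp (Finsupp.mem_support_iff.2 (Ne.symm h)))

variable {R : Type*} [CommRing R] {i : ℕ} {g : ℕ → Prop}

lemma multiplicitySeries_of_iff_eq (hi : 0 < i) (k : ℕ) (hg : ∀ c, g c ↔ c = k) :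
    multiplicitySeries R i g = X ^ (i * k) := by
  ext t
  rw [multiplicitySeries, coeff_mk, coeff_X_pow]
  congr 1
  rw [hg, eq_iff_iff]
  constructor
  · rintro ⟨h, rfl⟩
    exact (Nat.mul_div_cancel' h).symm
  · rintro rfl
    exact ⟨dvd_mul_right _ _, Nat.mul_div_cancel_left _ hi⟩

lemma multiplicitySeries_of_iff_le_one (hi : 0 < i) (hg : ∀ c, g c ↔ c = 0 ∨ c = 1) :
    multiplicitySeries R i g = 1 + X ^ i := by
  ext t
  rw [multiplicitySeries, coeff_mk, map_add, coeff_X_pow, coeff_one, hg]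
  by_cases h0 : t = 0
  · subst h0
    simp [hi.ne]
  by_cases h1 : t = i
  · subst h1
    simp [hi, h0]
  · rw [if_neg, if_neg h0, if_neg h1, add_zero]
    rintro ⟨⟨c, rfl⟩, h⟩
    rw [Nat.mul_div_cancel_left _ hi] at h
    rcases h with rfl | rfl <;> simp at h0 h1

lemma one_sub_mul_multiplicitySeries_of_forall (hi : 0 < i) (hg : ∀ c, g c) :
    (1 - X ^ i) * multiplicitySeries R i g = 1 := by
  ext t
  simp only [multiplicitySeries, sub_mul, one_mul, map_sub, coeff_mk, coeff_X_pow_mul', hg,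
    and_true, coeff_one]
  by_cases ht : i ≤ t
  · obtain ⟨d, rfl⟩ := Nat.exists_eq_add_of_le ht
    simp [hi.ne']
  · rw [if_neg ht, sub_zero]
    congr 1
    rw [eq_iff_iff]
    constructor
    · intro h
      exact Nat.eq_zero_of_dvd_of_lt h (by omega)
    · rintro rfl
      exact dvd_zero _

end PartitionCount

/-! ### The generating function for fixed j. -/

section InitialRepetitions

open PowerSeries

/-- The condition on the multiplicity `c` of the part `i` in a partition with initial even
repetitions up to `2 * j`. -/
def MultiplicityCondition (j i c : ℕ) : Prop :=
  (Even i → (i ≤ 2 * j → c = 2) ∧ (2 * j < i → c ≠ 0 → 4 * j + 2 ≤ i ∧ c = 1)) ∧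
  (Odd i → c ≠ 0 → i ≤ 2 * j + 1 ∧ (i ≤ 2 * j - 1 → c = 1))

lemma multiplicityCondition_even (j m c : ℕ) : MultiplicityCondition j (2 * m + 2) c ↔
    (m < j → c = 2) ∧ (j ≤ m → c ≠ 0 → 2 * j ≤ m ∧ c = 1) := by
  have h1 : Even (2 * m + 2) := ⟨m + 1, by ring⟩
  have h2 : ¬ Odd (2 * m + 2) := by rwa [Nat.not_odd_iff_even]
  simp only [MultiplicityCondition, h1, h2, true_implies, false_implies, and_true]
  grind

lemma multiplicityCondition_odd (j m c : ℕ) : MultiplicityCondition j (2 * m + 1) c ↔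
    (c ≠ 0 → m ≤ j ∧ (m < j → c = 1)) := by
  have h1 : Odd (2 * m + 1) := ⟨m, by ring⟩
  have h2 : ¬ Even (2 * m + 1) := by rwa [Nat.not_even_iff_odd]
  simp only [MultiplicityCondition, h1, h2, true_implies, false_implies, true_and]
  grind

lemma prod_range_two_mul {A : Type*} [CommMonoid A] (f : ℕ → A) (K : ℕ) :
    ∏ i ∈ range (2 * K), f i = (∏ m ∈ range K, f (2 * m)) * ∏ m ∈ range K, f (2 * m + 1) := by
  induction K with
  | zero => simp
  | succ K ih =>
    rw [show 2 * (K + 1) = 2 * K + 1 + 1 by ring, prod_range_succ, prod_range_succ, ih,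
      prod_range_succ, prod_range_succ]
    simp only [mul_assoc, mul_left_comm, mul_comm]

lemma prod_odd_multiplicitySeries (R : Type*) [CommRing R] (j d : ℕ) :
    ∏ m ∈ range (j + (1 + d)),
        multiplicitySeries R (2 * m + 1) (MultiplicityCondition j (2 * m + 1)) =
      (∏ m ∈ range j, (1 + X ^ (2 * m + 1))) *
        multiplicitySeries R (2 * j + 1) (MultiplicityCondition j (2 * j + 1)) := by
  rw [prod_range_add, prod_range_add, prod_range_one]
  have h : ∀ x ∈ range d, multiplicitySeries R (2 * (j + (1 + x)) + 1)
      (MultiplicityCondition j (2 * (j + (1 + x)) + 1)) = 1 := by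
    intro x _
    rw [multiplicitySeries_of_iff_eq (by omega) 0, mul_zero, pow_zero]
    intro c
    rw [multiplicityCondition_odd]
    grind
  rw [prod_congr rfl h, prod_const_one, mul_one, add_zero]
  congr 1
  refine prod_congr rfl fun m hm => multiplicitySeries_of_iff_le_one (by omega) fun c => ?_
  have := mem_range.1 hm
  rw [multiplicityCondition_odd]
  grind

lemma prod_even_multiplicitySeries (R : Type*) [CommRing R] (j d : ℕ) :
    ∏ m ∈ range (j + (j + d)),
        multiplicitySeries R (2 * m + 2) (MultiplicityCondition j (2 * m + 2)) =
      (X ^ 2) ^ (j ^ 2 + j) * ∏ m ∈ range d, (1 + (X ^ 2) ^ (2 * j + 1 + m)) := by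
  rw [prod_range_add, prod_range_add]
  have h : ∀ x ∈ range j, multiplicitySeries R (2 * (j + x) + 2)
      (MultiplicityCondition j (2 * (j + x) + 2)) = 1 := by
    intro x hx
    have := mem_range.1 hx
    rw [multiplicitySeries_of_iff_eq (by omega) 0, mul_zero, pow_zero]
    intro c
    rw [multiplicityCondition_even]
    grind
  rw [prod_congr rfl h, prod_const_one, one_mul]
  congr 1
  · have h2 : ∀ m ∈ range j, multiplicitySeries R (2 * m + 2)
        (MultiplicityCondition j (2 * m + 2)) = (X ^ 2) ^ (2 * m + 2) := by
      intro m hm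
      have := mem_range.1 hm
      rw [multiplicitySeries_of_iff_eq (by omega) 2, mul_comm, pow_mul]
      intro c
      rw [multiplicityCondition_even]
      grind
    rw [prod_congr rfl h2, prod_pow_eq_pow_sum]
    congr 1
    clear h h2
    induction j with
    | zero => simp
    | succ j ih => rw [sum_range_succ, ih]; ring
  · refine prod_congr rfl fun m _ => ?_
    rw [multiplicitySeries_of_iff_le_one (by omega), ← pow_mul]
    · congr 2; ring
    · intro c
      rw [multiplicityCondition_even]
      grind

lemma prod_multiplicitySeries {R : Type*} [CommRing R] [CharP (PowerSeries R) 2] {j L : ℕ}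
    (hj : j ≤ L) :
    ∏ i ∈ Icc 1 (2 * (2 * L + 1)), multiplicitySeries R i (MultiplicityCondition j i) =
      (X ^ 2) ^ (j ^ 2 + j) * (∏ i ∈ range (j + 1), (1 + X ^ (2 * i + 1))) *
        qRise (X ^ 2) (2 * j + 1) (2 * (L - j)) := by
  obtain ⟨d, rfl⟩ := Nat.exists_eq_add_of_le hj
  have hIcc : ∀ (f : ℕ → PowerSeries R) (B : ℕ), ∏ i ∈ Icc 1 B, f i = ∏ i ∈ range B, f (i + 1) :=
    fun f B => by
      rw [range_eq_Ico, prod_Ico_add' f 0 B 1]; rfl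
  have hG := one_sub_mul_multiplicitySeries_of_forall (R := R) (i := 2 * j + 1)
    (g := MultiplicityCondition j (2 * j + 1)) (by omega)
    (fun c => by rw [multiplicityCondition_odd]; omega)
  have hodd := prod_odd_multiplicitySeries R j (j + 2 * d)
  have heven := prod_even_multiplicitySeries R j (2 * d + 1)
  rw [show j + (1 + (j + 2 * d)) = 2 * (j + d) + 1 by ring] at hodd
  rw [show j + (j + (2 * d + 1)) = 2 * (j + d) + 1 by ring] at heven
  have hrise : ∏ m ∈ range (2 * d + 1), (1 + ((X : PowerSeries R) ^ 2) ^ (2 * j + 1 + m)) =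
      (1 - (X ^ 2) ^ (2 * j + 1)) * qRise (X ^ 2) (2 * j + 1) (2 * d) := by
    rw [← qRise_succ', qRise]
    exact prod_congr rfl fun m _ => (CharTwo.sub_eq_add _ _).symm
  -- The factor of the even part 4j+2 absorbs the geometric series of the odd part 2j+1.
  have hsq : (1 - ((X : PowerSeries R) ^ 2) ^ (2 * j + 1)) =
      (1 + X ^ (2 * j + 1)) * (1 - X ^ (2 * j + 1)) := by ring
  rw [hIcc, prod_range_two_mul, hodd, heven, hrise, hsq, prod_range_succ,
    show j + d - j = d by omega]
  linear_combination (∏ m ∈ range j, (1 + (X : PowerSeries R) ^ (2 * m + 1))) *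
    (X ^ 2) ^ (j ^ 2 + j) * (1 + X ^ (2 * j + 1)) * qRise (X ^ 2) (2 * j + 1) (2 * d) * hG

end InitialRepetitions

/-! ### Splitting the count according to j. -/

section Enumeration

variable {n : ℕ}

lemma multiplicityCondition_zero_iff (p : n.Partition) {B : ℕ} (hB : n ≤ B) :
    (∀ i ∈ Icc 1 B, MultiplicityCondition 0 i (p.parts.count i)) ↔
      OnlyOneOddDistinctEven p := by
  have hmem : ∀ i, p.parts.count i ≠ 0 ↔ i ∈ p.parts := fun i => Multiset.count_ne_zero
  have hle : ∀ i ∈ p.parts, i ∈ Icc 1 B := fun i hi =>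
    mem_Icc.2 ⟨p.parts_pos hi, (p.le_of_mem_parts hi).trans hB⟩
  constructor
  · intro h
    refine ⟨fun i hi ho => ?_, fun i hi he => ?_⟩
    · have h1 := ((h i (hle i hi)).2 ho ((hmem i).2 hi)).1
      have := p.parts_pos hi
      omega
    · have := p.parts_pos hi
      exact (((h i (hle i hi)).1 he).2 (by omega) ((hmem i).2 hi)).2
  · rintro ⟨h1, h2⟩ i hi
    have hi1 := (mem_Icc.1 hi).1
    refine ⟨fun he => ⟨fun h => by omega, fun _ hc => ?_⟩, fun ho hc => ?_⟩
    · refine ⟨?_, h2 i ((hmem i).1 hc) he⟩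
      obtain ⟨k, rfl⟩ := he
      omega
    · have := h1 i ((hmem i).1 hc) ho
      exact ⟨by omega, fun h => by omega⟩

lemma hasInitialEvenRepetitions_iff (p : n.Partition) {B : ℕ} (hB : 2 * n ≤ B) :
    HasInitialEvenRepetitions p ↔
      ∃ j, 1 ≤ j ∧ j ≤ n ∧ ∀ i ∈ Icc 1 B, MultiplicityCondition j i (p.parts.count i) := by
  have hmem : ∀ i, p.parts.count i ≠ 0 ↔ i ∈ p.parts := fun i => Multiset.count_ne_zero
  have hle : ∀ i ∈ p.parts, i ∈ Icc 1 B := fun i hi =>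
    mem_Icc.2 ⟨p.parts_pos hi, (p.le_of_mem_parts hi).trans (by omega)⟩
  constructor
  · rintro ⟨j, hj, h1, h2, h3, h4⟩
    have hjn : 2 * j ≤ n := p.le_of_mem_parts ((hmem _).1 (by rw [h1 j hj le_rfl]; norm_num))
    refine ⟨j, hj, by omega, fun i hi => ⟨fun he => ⟨fun h => ?_, fun h hc => ?_⟩,
      fun ho hc => ⟨h3 i ((hmem i).1 hc) ho, fun h => h4 i ((hmem i).1 hc) ho h⟩⟩⟩
    · have hi1 := (mem_Icc.1 hi).1
      obtain ⟨k, rfl⟩ := he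
      rw [← two_mul]
      exact h1 k (by omega) (by omega)
    · exact h2 i ((hmem i).1 hc) he h
  · rintro ⟨j, hj, hjn, h⟩
    refine ⟨j, hj, fun i hi1 hij => ?_, fun i hi he hlt => ?_, fun i hi ho => ?_,
      fun i hi ho hlt => ?_⟩
    · exact ((h (2 * i) (mem_Icc.2 ⟨by omega, by omega⟩)).1 (even_two_mul i)).1 (by omega)
    · exact ((h i (hle i hi)).1 he).2 hlt ((hmem i).2 hi)
    · exact ((h i (hle i hi)).2 ho ((hmem i).2 hi)).1
    · exact ((h i (hle i hi)).2 ho ((hmem i).2 hi)).2 hlt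

/-- The part 2(j+1) would occur twice by the condition for j' and at most once by that for j. -/
lemma multiplicityCondition_not_both (p : n.Partition) {B j j' : ℕ} (hB : 2 * n ≤ B)
    (hj' : j' ≤ n) (hjj' : j < j')
    (h : ∀ i ∈ Icc 1 B, MultiplicityCondition j i (p.parts.count i))
    (h' : ∀ i ∈ Icc 1 B, MultiplicityCondition j' i (p.parts.count i)) : False := by
  have hi : 2 * (j + 1) ∈ Icc 1 B := mem_Icc.2 ⟨by omega, by omega⟩
  have h1 := ((h' _ hi).1 (even_two_mul _)).1 (by omega)
  have h2 := (((h _ hi).1 (even_two_mul _)).2 (by omega) (by omega)).2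
  omega

lemma c₆_eq_sum (n : ℕ) {B : ℕ} (hB : 2 * n ≤ B) :
    c₆ n = ∑ j ∈ range (n + 1), Nat.card
      {p : n.Partition // ∀ i ∈ Icc 1 B, MultiplicityCondition j i (p.parts.count i)} := by
  classical
  simp only [c₆, Nat.card_eq_fintype_card, Fintype.card_subtype]
  rw [← card_biUnion]
  · congr 1
    ext p
    simp only [mem_filter, mem_univ, true_and, mem_biUnion, mem_range, Nat.lt_succ_iff]
    rw [← multiplicityCondition_zero_iff p (by omega : n ≤ B), hasInitialEvenRepetitions_iff p hB]
    constructor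
    · rintro (h | ⟨j, -, hjn, h⟩)
      · exact ⟨0, Nat.zero_le _, h⟩
      · exact ⟨j, hjn, h⟩
    · rintro ⟨j, hjn, h⟩
      rcases Nat.eq_zero_or_pos j with rfl | hj
      · exact Or.inl h
      · exact Or.inr ⟨j, hj, hjn, h⟩
  · intro j hj j' hj' hne
    rw [Function.onFun, disjoint_left]
    intro p hp hp'
    simp only [mem_filter, mem_univ, true_and] at hp hp'
    have hj := mem_range.1 (mem_coe.1 hj)
    have hj' := mem_range.1 (mem_coe.1 hj')
    rcases lt_or_gt_of_ne hne with h | h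
    · exact multiplicityCondition_not_both p hB (by omega) h hp hp'
    · exact multiplicityCondition_not_both p hB (by omega) h hp' hp

end Enumeration

/-! ### Passage from the finite identity to coefficients. -/

section ModTwo

open PowerSeries

lemma coeff_eq_of_X_pow_dvd_sub {R : Type*} [CommRing R] {a b : PowerSeries R} {N : ℕ}
    (h : X ^ (N + 1) ∣ a - b) : coeff N a = coeff N b := by
  have := X_pow_dvd_iff.1 h N (Nat.lt_succ_self N)
  rwa [map_sub, sub_eq_zero] at this

instance : CharP (PowerSeries (ZMod 2)) 2 :=
  charP_of_injective_ringHom C_injective 2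

lemma c₆_cast_eq_sum (N : ℕ) : (c₆ N : ZMod 2) = ∑ s ∈ range (N + 1),
    ((if N = genPentagonal s + 2 * (s ^ 2 + s) then 1 else 0) +
      (if N = genPentagonal s + 2 * (s ^ 2 + s) + (2 * s + 1) then 1 else 0)) := by
  have hq : ∀ n : ℕ, 1 - ((X : PowerSeries (ZMod 2)) ^ 2) ^ (n + 1) ≠ 0 := by
    intro n h
    have := congrArg (coeff 0) h
    simp at this
  have key := congrArg (coeff N) (rogersSelberg_finite (X : PowerSeries (ZMod 2)) hq N)
  rw [map_sum, map_sum] at key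
  rw [c₆_eq_sum N (B := 2 * (2 * N + 1)) (by omega), Nat.cast_sum]
  calc _ = _ := sum_congr rfl fun j hj => ?_
    _ = _ := key
    _ = _ := sum_congr rfl fun s hs => ?_
  · have hj' : j ≤ N := Nat.lt_succ_iff.1 (mem_range.1 hj)
    rw [← coeff_prod_multiplicitySeries (ZMod 2) (MultiplicityCondition j) (by omega),
      prod_multiplicitySeries hj']
    refine (coeff_eq_of_X_pow_dvd_sub ?_).symm
    rw [← mul_sub_one, mul_assoc, mul_assoc]
    have h := mul_dvd_mul_left (((X : PowerSeries (ZMod 2)) ^ 2) ^ (j ^ 2 + j))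
      (pow_dvd_qRise_sub_one ((X : PowerSeries (ZMod 2)) ^ 2) (N - j) j)
    rw [← pow_add, ← pow_mul] at h
    have h2 := (pow_dvd_pow (X : PowerSeries (ZMod 2))
      (show N + 1 ≤ 2 * (j ^ 2 + j + (N - j + 1)) by
        have := Nat.zero_le (j ^ 2); omega)).trans h
    refine h2.trans (mul_dvd_mul_left _ ?_)
    exact (dvd_mul_left _ _).mul_left _
  · have hs' : s ≤ N := Nat.lt_succ_iff.1 (mem_range.1 hs)
    have hR : ((X : PowerSeries (ZMod 2)) ^ 2) ^ (N - s + 1) ∣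
        qRise (X ^ 2) (N - s) s * qRise (X ^ 2) (N + s + 1) (N - s) - 1 := by
      have h1 := pow_dvd_qRise_sub_one ((X : PowerSeries (ZMod 2)) ^ 2) (N - s) s
      have h2 := (pow_dvd_pow ((X : PowerSeries (ZMod 2)) ^ 2)
        (show N - s + 1 ≤ N + s + 1 + 1 by omega)).trans
        (pow_dvd_qRise_sub_one (X ^ 2) (N + s + 1) (N - s))
      -- Uses ab - 1 = (a - 1)b + (b - 1).
      convert dvd_add (h1.mul_right (qRise (X ^ 2) (N + s + 1) (N - s))) h2 using 1
      ring
    calc _ = coeff N ((X : PowerSeries (ZMod 2)) ^ genPentagonal s * (1 + X ^ (2 * s + 1)) *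
          (X ^ 2) ^ (s ^ 2 + s)) := by
          refine coeff_eq_of_X_pow_dvd_sub ?_
          rw [← mul_sub_one, mul_assoc]
          refine Dvd.dvd.mul_left ?_ _
          have h := mul_dvd_mul_left (((X : PowerSeries (ZMod 2)) ^ 2) ^ (s ^ 2 + s)) hR
          rw [← pow_add, ← pow_mul] at h
          exact (pow_dvd_pow (X : PowerSeries (ZMod 2))
            (show N + 1 ≤ 2 * (s ^ 2 + s + (N - s + 1)) by
              have := Nat.zero_le (s ^ 2); omega)).trans h
      _ = coeff N ((X : PowerSeries (ZMod 2)) ^ (genPentagonal s + 2 * (s ^ 2 + s)) +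
          X ^ (genPentagonal s + 2 * (s ^ 2 + s) + (2 * s + 1))) := by
          congr 1; ring
      _ = _ := by rw [map_add, coeff_X_pow, coeff_X_pow]

lemma exists_int_iff (N : ℕ) :
    (∃ j : ℤ, (N : ℚ) = (7 * (j : ℚ) ^ 2 + 5 * (j : ℚ)) / 2) ↔
      ∃ j : ℤ, 2 * (N : ℤ) = 7 * j ^ 2 + 5 * j := by
  refine exists_congr fun j => ?_
  rw [eq_div_iff two_ne_zero, mul_comm]
  exact_mod_cast Iff.rfl

end ModTwo

theorem theorem7 (n : ℕ) :
    ((∃ j : ℤ, (n : ℚ) = (7 * (j : ℚ) ^ 2 + 5 * (j : ℚ)) / 2) → c₆ n ≡ 1 [MOD 2]) ∧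
    ((¬ ∃ j : ℤ, (n : ℚ) = (7 * (j : ℚ) ^ 2 + 5 * (j : ℚ)) / 2) → c₆ n ≡ 0 [MOD 2]) := by
  have hpos : ∀ s : ℕ, n = genPentagonal s + 2 * (s ^ 2 + s) ↔
      2 * (n : ℤ) = 7 * (s : ℤ) ^ 2 + 5 * s := by
    intro s
    have h := two_mul_genPentagonal s
    zify
    constructor <;> intro h' <;> linarith
  have hneg : ∀ s : ℕ, n = genPentagonal s + 2 * (s ^ 2 + s) + (2 * s + 1) ↔
      2 * (n : ℤ) = 7 * (-1 - s : ℤ) ^ 2 + 5 * (-1 - s) := by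
    intro s
    have h := two_mul_genPentagonal s
    zify
    constructor <;> intro h' <;> linarith
  have huniq : ∀ j k : ℤ, 2 * (n : ℤ) = 7 * j ^ 2 + 5 * j → 2 * (n : ℤ) = 7 * k ^ 2 + 5 * k →
      j = k := by
    intro j k hj hk
    have h : (j - k) * (7 * (j + k) + 5) = 0 := by linarith
    -- 7(j + k) + 5 never vanishes, since 7 does not divide 5.
    rcases mul_eq_zero.1 h with h | h <;> omega
  rw [exists_int_iff, ← ZMod.natCast_eq_natCast_iff, ← ZMod.natCast_eq_natCast_iff,
    c₆_cast_eq_sum]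
  simp only [hpos, hneg]
  constructor
  · rintro ⟨j, hj⟩
    obtain ⟨s, hs⟩ : ∃ s : ℕ, j = s ∨ j = -1 - s := by
      rcases le_or_gt 0 j with h | h
      · exact ⟨j.toNat, Or.inl (by omega)⟩
      · exact ⟨(-1 - j).toNat, Or.inr (by omega)⟩
    have hsn : s ≤ n := by
      rcases hs with rfl | rfl
      · have := (hpos s).2 hj
        have h2 := Nat.zero_le (s ^ 2)
        omega
      · have := (hneg s).2 hj
        have h2 := Nat.zero_le (s ^ 2)
        omega
    rw [sum_eq_single s]
    · rcases hs with rfl | rfl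
      · rw [if_pos hj, if_neg, add_zero, Nat.cast_one]
        intro h
        have := huniq _ _ hj h
        omega
      · rw [if_pos hj, if_neg, zero_add, Nat.cast_one]
        intro h
        have := huniq _ _ hj h
        omega
    · intro t _ hts
      rw [if_neg, if_neg, add_zero]
      · intro h
        have := huniq _ _ hj h
        omega
      · intro h
        have := huniq _ _ hj h
        omega
    · intro h
      exact absurd (mem_range.2 (by omega)) h
  · intro h
    rw [Nat.cast_zero]
    refine sum_eq_zero fun s _ => ?_
    rw [if_neg fun h' => h ⟨_, h'⟩, if_neg fun h' => h ⟨_, h'⟩, add_zero]
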